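/- All compact spaces are Hausdorff. An r-skeleton (retractional skeleton) in a compact space $K$ is a family $\{R_s\}_{s\in\Gamma}$ of continuous retractions $R_s\colon K\to K$ (i.e. $R_s\circ R_s=R_s$) onto metrizable subsets of $K$, indexed by a nonempty up-directed partially ordered set $\Gamma$, such that (i) if $s\le t$ then $R_s=R_s\circ R_t=R_t\circ R_s$; (ii) $x=\lim_{s\in\Gamma}R_s(x)$ for every $x\in K$; (iii) if $s_0<s_1<s_2<\cdots$ in $\Gamma$, then $t=\sup_n s_n$ exists in $\Gamma$ and $R_t(x)=\lim_{n\to\infty}R_{s_n}(x)$ for every $x\in K$. Theorem. Let $\{R_s\}_{s\in\Gamma}$ be an r-skeleton in a compact space $K$ and let $D=\bigcup_{s\in\Gamma}R_s[K]$, with the subspace topology. Then: (1) $D$ is dense in $K$, and for every countable set $A\subseteq D$ the closure $\overline{A}$ of $A$ in $K$ is metrizable and contained in $D$. (2) $D$ is countably tight: for every $A\subseteq D$ and every $p\in D$ in the closure of $A$ there is a countable $A_0\subseteq A$ with $p$ in the closure of $A_0$. (3) $D$ is a normal space and $K=\beta D$, i.e. there is a homeomorphism from the Čech–Stone compactification $\beta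 D$ onto $K$ which restricts to the identity on $D$. -/

import Mathlib

open Set Filter Topology

/-- A retractional skeleton (r-skeleton) in a space `K`: a family of (continuous) retractions
`R s : K → K` onto metrizable subsets, indexed by a (nonempty) up-directed partially ordered set
`Γ`. -/
structure IsRSkeleton {K Γ : Type*} [TopologicalSpace K] [PartialOrder Γ] (R : Γ → K → K) :
    Prop where
  nonempty : Nonempty Γ
  directed : ∀ s t : Γ, ∃ u : Γ, s ≤ u ∧ t ≤ u
  continuous : ∀ s, Continuous (R s)
  idempotent : ∀ s, R s ∘ R s = R s
  metrizable : ∀ s, TopologicalSpace.MetrizableSpace (range (R s))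
  comp_of_le : ∀ s t, s ≤ t → R s = R s ∘ R t ∧ R s = R t ∘ R s
  tendsto : ∀ x, Tendsto (fun s => R s x) atTop (𝓝 x)
  exists_sup : ∀ s : ℕ → Γ, StrictMono s →
    ∃ t, IsLUB (range s) t ∧ ∀ x, Tendsto (fun n => R (s n) x) atTop (𝓝 (R t x))

/-- The set `⋃ s, R s [K]` induced by a family of maps `R s : K → K`. -/
def inducedSet {K Γ : Type*} (R : Γ → K → K) : Set K :=
  ⋃ s, range (R s)

/-- A space is countably tight if each point of the closure of a set `A` belongs to the closure of
a countable subset of `A`. -/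
def IsCountablyTight (X : Type*) [TopologicalSpace X] : Prop :=
  ∀ (A : Set X) (p : X), p ∈ closure A → ∃ A₀ ⊆ A, A₀.Countable ∧ p ∈ closure A₀

namespace IsRSkeleton

variable {K Γ : Type*} [TopologicalSpace K] [PartialOrder Γ] {R : Γ → K → K}

/-! Write D for the induced set. Directedness and suprema of sequences place any countable part of D
inside one compact metrizable range, which gives (1). The rest is a closing-off argument,
`exists_apply_mem_closure_inter`: if `p` lies in the closures of `A, B ⊆ D`, indices are enlarged
countably often to capture countable sets whose images are dense in those of `A` and `B`; at the
limit index `t`, compactness puts `R t p` in both closures. For `p` in D, a large starting index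
gives `R t p = p`, hence tightness. For `A`, `B` closed in D, `R t p` is a common point of them even
if `p` is outside D. So disjoint closed sets of D have disjoint closures in `K`, which yields
normality and injectivity of `βD → K`. -/

theorem apply_apply (hR : IsRSkeleton R) {s t : Γ} (h : s ≤ t) (x : K) :
    R s (R t x) = R s x :=
  (congrFun (hR.comp_of_le s t h).1 x).symm

theorem apply_of_mem_range (hR : IsRSkeleton R) {s : Γ} {x : K} (hx : x ∈ range (R s)) :
    R s x = x := by
  obtain ⟨y, rfl⟩ := hx
  exact congrFun (hR.idempotent s) y

theorem range_mono (hR : IsRSkeleton R) {s t : Γ} (h : s ≤ t) : range (R s) ⊆ range (R t) := by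
  rintro _ ⟨x, rfl⟩
  exact ⟨R s x, (congrFun (hR.comp_of_le s t h).2 x).symm⟩

/-- A weakly increasing sequence of indices has an upper bound whose retraction is determined by
the retractions along the sequence. -/
theorem exists_upper_of_monotone [T2Space K] (hR : IsRSkeleton R) {s : ℕ → Γ}
    (hs : Monotone s) :
    ∃ t, (∀ n, s n ≤ t) ∧ ∀ x y, (∀ n, R (s n) x = R (s n) y) → R t x = R t y := by
  -- Suprema are only granted for strictly increasing sequences: an eventually constant sequence is
  -- bounded by its final value, and any other has a strictly increasing subsequence.
  by_cases hc : ∃ N, ∀ n ≥ N, s n = s N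
  · obtain ⟨N, hN⟩ := hc
    refine ⟨s N, fun n => ?_, fun x y h => h N⟩
    rcases le_total n N with h | h
    · exact hs h
    · exact (hN n h).le
  · push Not at hc
    choose g hg hne using hc
    have hlt : ∀ n, s n < s (g n) := fun n => lt_of_le_of_ne (hs (hg n)) (hne n).symm
    let φ : ℕ → ℕ := fun n => g^[n] 0
    have hφ : ∀ n, φ (n + 1) = g (φ n) := fun n => Function.iterate_succ_apply' g n 0
    have hsφ : StrictMono (s ∘ φ) := strictMono_nat_of_lt_succ fun n => by
      simpa only [Function.comp_apply, hφ] using hlt (φ n)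
    have hφm : StrictMono φ := fun a b hab => hs.reflect_lt (hsφ hab)
    obtain ⟨t, ht, hlim⟩ := hR.exists_sup _ hsφ
    refine ⟨t, fun n => (hs (hφm.le_apply (x := n))).trans (ht.1 ⟨n, rfl⟩), fun x y h => ?_⟩
    refine tendsto_nhds_unique (hlim x) ?_
    simpa only [Function.comp_apply, h] using hlim y

theorem exists_ge_forall_nat_le [T2Space K] (hR : IsRSkeleton R) (s₀ : Γ) (s : ℕ → Γ) :
    ∃ t, s₀ ≤ t ∧ ∀ n, s n ≤ t := by
  choose u hu₁ hu₂ using hR.directed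
  let v : ℕ → Γ := fun n => Nat.rec s₀ (fun n a => u a (s n)) n
  obtain ⟨t, ht, -⟩ := hR.exists_upper_of_monotone
    (monotone_nat_of_le_succ (f := v) fun n => hu₁ (v n) (s n))
  exact ⟨t, ht 0, fun n => (hu₂ (v n) (s n)).trans (ht (n + 1))⟩

/-- Every countable subset of the induced set is contained in the range of one retraction. -/
theorem exists_ge_subset_range [T2Space K] (hR : IsRSkeleton R) (s₀ : Γ) {A : Set K}
    (hA : A ⊆ inducedSet R) (hc : A.Countable) : ∃ t, s₀ ≤ t ∧ A ⊆ range (R t) := by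
  rcases A.eq_empty_or_nonempty with rfl | hne
  · exact ⟨s₀, le_rfl, empty_subset _⟩
  obtain ⟨f, rfl⟩ := hc.exists_eq_range hne
  have hf : ∀ n, ∃ s, f n ∈ range (R s) := fun n => mem_iUnion.1 (hA ⟨n, rfl⟩)
  choose s hs using hf
  obtain ⟨t, h₀, ht⟩ := hR.exists_ge_forall_nat_le s₀ s
  refine ⟨t, h₀, ?_⟩
  rintro _ ⟨n, rfl⟩
  exact hR.range_mono (ht n) (hs n)

theorem isCompact_range [CompactSpace K] (hR : IsRSkeleton R) (s : Γ) :
    IsCompact (range (R s)) :=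
  _root_.isCompact_range (hR.continuous s)

theorem closure_subset_range [CompactSpace K] [T2Space K] (hR : IsRSkeleton R) {s : Γ}
    {A : Set K} (hA : A ⊆ range (R s)) : closure A ⊆ range (R s) :=
  closure_minimal hA (hR.isCompact_range s).isClosed

theorem dense_inducedSet (hR : IsRSkeleton R) : Dense (inducedSet R) := by
  have := hR.nonempty
  have : IsDirectedOrder Γ := ⟨hR.directed⟩
  exact fun x => mem_closure_of_tendsto (hR.tendsto x)
    (Eventually.of_forall fun s => mem_iUnion.2 ⟨s, x, rfl⟩)

/-- Compact metrizable spaces are second countable, so every subspace of the range is separable; a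
countable dense subset of the image is lifted to `A`. -/
theorem exists_countable_image_subset_closure [CompactSpace K] (hR : IsRSkeleton R) (s : Γ)
    (A : Set K) : ∃ A₀ ⊆ A, A₀.Countable ∧ R s '' A ⊆ closure (R s '' A₀) := by
  have := hR.metrizable s
  have : CompactSpace (range (R s)) := isCompact_iff_compactSpace.1 (hR.isCompact_range s)
  let := TopologicalSpace.metrizableSpaceMetric (range (R s))
  have : SecondCountableTopology (range (R s)) := inferInstance
  have : SecondCountableTopology (R s '' A) :=
    (Topology.IsEmbedding.inclusion (image_subset_range (R s) A)).secondCountableTopology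
  obtain ⟨c, hc, hd⟩ := TopologicalSpace.exists_countable_dense (R s '' A)
  choose g hgA hg using fun y : R s '' A => y.2
  refine ⟨g '' c, ?_, hc.image g, fun y hy => ?_⟩
  · rintro _ ⟨y, -, rfl⟩
    exact hgA y
  · have := image_closure_subset_closure_image continuous_subtype_val
      (mem_image_of_mem Subtype.val (hd ⟨y, hy⟩))
    refine closure_mono ?_ this
    rintro _ ⟨z, hz, rfl⟩
    exact ⟨g z, ⟨z, hz, rfl⟩, hg z⟩

/-- Given a sequence of indices and a set containing countable sets witnessing density of the
images, the closure contains the image of `p` under the limiting retraction. -/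
theorem apply_mem_closure [CompactSpace K] [T2Space K] (hR : IsRSkeleton R) {s : ℕ → Γ}
    (hs : Monotone s) {t : Γ} (ht : ∀ x y, (∀ n, R (s n) x = R (s n) y) → R t x = R t y)
    {A : Set K} (hA : A ⊆ range (R t)) {p : K}
    (hp : ∀ n, R (s n) p ∈ closure (R (s n) '' A)) : R t p ∈ closure A := by
  -- `C n` collects the points of `closure A` that `R (s n)` does not separate from `p`. A point `q`
  -- common to all of them satisfies `R t q = R t p`, and `R t` fixes `q`.
  let C : ℕ → Set K := fun n => closure A ∩ R (s n) ⁻¹' {R (s n) p}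
  have hcl : ∀ n, IsClosed (C n) := fun n =>
    isClosed_closure.inter (isClosed_singleton.preimage (hR.continuous _))
  have hdec : ∀ n, C (n + 1) ⊆ C n := by
    rintro n q ⟨hq, hq'⟩
    refine ⟨hq, ?_⟩
    have h := hs (Nat.le_succ n)
    have hq' : R (s (n + 1)) q = R (s (n + 1)) p := hq'
    change R (s n) q = R (s n) p
    rw [← hR.apply_apply h q, ← hR.apply_apply h p]
    exact congrArg _ hq'
  have hne : ∀ n, (C n).Nonempty := fun n => by
    have h := hp n
    rw [← image_closure_of_isCompact isClosed_closure.isCompact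
      (hR.continuous _).continuousOn] at h
    obtain ⟨q, hq, hq'⟩ := h
    exact ⟨q, hq, hq'⟩
  obtain ⟨q, hq⟩ := IsCompact.nonempty_iInter_of_sequence_nonempty_isCompact_isClosed C hdec hne
    (hcl 0).isCompact hcl
  have hq : ∀ n, q ∈ C n := mem_iInter.1 hq
  have hqA : q ∈ closure A := (hq 0).1
  rw [← ht q p fun n => (hq n).2, hR.apply_of_mem_range (hR.closure_subset_range hA hqA)]
  exact hqA

/-- A common point of closures of two subsets of the induced set is retracted, by arbitrarily
large indices, to a common point of closures of countable subsets. -/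
theorem exists_apply_mem_closure_inter [CompactSpace K] [T2Space K] (hR : IsRSkeleton R)
    {A B : Set K} (hA : A ⊆ inducedSet R) (hB : B ⊆ inducedSet R) {p : K}
    (hpA : p ∈ closure A) (hpB : p ∈ closure B) (s₀ : Γ) :
    ∃ t, s₀ ≤ t ∧ ∃ A₀ ⊆ A, A₀.Countable ∧ ∃ B₀ ⊆ B, B₀.Countable ∧
      R t p ∈ closure A₀ ∧ R t p ∈ closure B₀ := by
  choose f hfA hfc hf using fun s => hR.exists_countable_image_subset_closure s A
  choose g hgB hgc hg using fun s => hR.exists_countable_image_subset_closure s B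
  choose u hu hur using fun s => hR.exists_ge_subset_range s
    (union_subset ((hfA s).trans hA) ((hgB s).trans hB)) ((hfc s).union (hgc s))
  -- Iterating `u` makes the range at stage `n + 1` contain the countable sets chosen at stage `n`,
  -- so the range of `R t` contains them all.
  let v : ℕ → Γ := fun n => u^[n] s₀
  have hv : ∀ n, v (n + 1) = u (v n) := fun n => Function.iterate_succ_apply' u n s₀
  have hmono : Monotone v := monotone_nat_of_le_succ fun n => (hu (v n)).trans (hv n).ge
  obtain ⟨t, hvt, ht⟩ := hR.exists_upper_of_monotone hmono
  have hsub : ∀ n, f (v n) ∪ g (v n) ⊆ range (R t) := fun n =>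
    (hur (v n)).trans (hR.range_mono ((hv n).ge.trans (hvt (n + 1))))
  have key : ∀ {C : Set K} {c : Γ → Set K}, p ∈ closure C →
      (∀ s, R s '' C ⊆ closure (R s '' c s)) → (∀ n, c (v n) ⊆ range (R t)) →
      R t p ∈ closure (⋃ n, c (v n)) := by
    intro C c hpC hc hcr
    refine hR.apply_mem_closure hmono ht (iUnion_subset hcr) fun n => ?_
    have h₁ : R (v n) p ∈ closure (R (v n) '' C) :=
      image_closure_subset_closure_image (hR.continuous _) (mem_image_of_mem _ hpC)
    have h₂ := closure_minimal (hc (v n)) isClosed_closure h₁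
    exact closure_mono (image_mono (subset_iUnion (fun n => c (v n)) n)) h₂
  exact ⟨t, hvt 0, ⋃ n, f (v n), iUnion_subset fun n => hfA _,
    countable_iUnion fun n => hfc _, ⋃ n, g (v n), iUnion_subset fun n => hgB _,
    countable_iUnion fun n => hgc _,
    key hpA hf fun n => subset_union_left.trans (hsub n),
    key hpB hg fun n => subset_union_right.trans (hsub n)⟩

theorem isCountablyTight [CompactSpace K] [T2Space K] (hR : IsRSkeleton R) :
    IsCountablyTight (inducedSet R) := by
  intro A p hp
  rw [closure_subtype] at hp
  obtain ⟨s₀, hs₀⟩ := mem_iUnion.1 p.2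
  have hA : Subtype.val '' A ⊆ inducedSet R := Subtype.coe_image_subset _ _
  obtain ⟨t, hst, A₀, hA₀, hc, -, -, -, hpt, -⟩ :=
    hR.exists_apply_mem_closure_inter hA hA hp hp s₀
  rw [hR.apply_of_mem_range (hR.range_mono hst hs₀)] at hpt
  obtain ⟨A₁, hA₁, rfl⟩ := subset_image_iff.1 hA₀
  exact ⟨A₁, hA₁, countable_of_injective_of_countable_image Subtype.val_injective.injOn hc,
    closure_subtype.2 hpt⟩

/-- Disjoint closed subsets of the induced set have disjoint closures in the whole space. -/
theorem disjoint_closure_image [CompactSpace K] [T2Space K] (hR : IsRSkeleton R)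
    {A B : Set (inducedSet R)} (hA : IsClosed A) (hB : IsClosed B) (hAB : Disjoint A B) :
    Disjoint (closure (Subtype.val '' A : Set K)) (closure (Subtype.val '' B)) := by
  refine disjoint_left.2 fun p hpA hpB => ?_
  obtain ⟨s₀⟩ := hR.nonempty
  obtain ⟨t, -, A₀, hA₀, -, B₀, hB₀, -, htA, htB⟩ := hR.exists_apply_mem_closure_inter
    (Subtype.coe_image_subset _ A) (Subtype.coe_image_subset _ B) hpA hpB s₀
  let q : inducedSet R := ⟨R t p, mem_iUnion.2 ⟨t, p, rfl⟩⟩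
  have hqA : q ∈ A := hA.closure_subset (closure_subtype.2 (closure_mono hA₀ htA))
  have hqB : q ∈ B := hB.closure_subset (closure_subtype.2 (closure_mono hB₀ htB))
  exact disjoint_left.1 hAB hqA hqB

theorem normalSpace_inducedSet [CompactSpace K] [T2Space K] (hR : IsRSkeleton R) :
    NormalSpace (inducedSet R) where
  normal A B hA hB hAB := by
    have h := (normal_separation
      isClosed_closure isClosed_closure (hR.disjoint_closure_image hA hB hAB)).preimage
      (continuous_subtype_val (p := (· ∈ inducedSet R)))
    exact h.mono (fun a ha => subset_closure ⟨a, ha, rfl⟩)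
      (fun b hb => subset_closure ⟨b, hb, rfl⟩)

theorem stoneCechExtend_bijective [CompactSpace K] [T2Space K] (hR : IsRSkeleton R) :
    Function.Bijective
      (stoneCechExtend (continuous_subtype_val (p := (· ∈ inducedSet R)))) := by
  set i : inducedSet R → K := Subtype.val
  have hi : Continuous i := continuous_subtype_val
  have hcont : Continuous (stoneCechExtend hi) := continuous_stoneCechExtend hi
  have hext : ∀ d, stoneCechExtend hi (stoneCechUnit d) = i d :=
    congrFun (stoneCechExtend_extends hi)
  constructor
  · intro x y hxy
    by_contra hne
    -- Closed neighbourhoods are needed so that their traces on D are disjoint closed sets, whose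
    -- closures in `K` cannot share the common image of `x` and `y`.
    obtain ⟨U, hU, V, hV, hUc, hVc, hUV⟩ :
        ∃ U ∈ 𝓝 x, ∃ V ∈ 𝓝 y, IsClosed U ∧ IsClosed V ∧ Disjoint U V := by
      obtain ⟨U, hxU, hU, V, hyV, hV, hUV⟩ := exists_open_nhds_disjoint_closure hne
      exact ⟨closure U, mem_of_superset (hU.mem_nhds hxU) subset_closure, closure V,
        mem_of_superset (hV.mem_nhds hyV) subset_closure, isClosed_closure, isClosed_closure, hUV⟩
    have key : ∀ {z : StoneCech (inducedSet R)} {W : Set (StoneCech (inducedSet R))},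
        W ∈ 𝓝 z → stoneCechExtend hi z ∈ closure (i '' (stoneCechUnit ⁻¹' W)) := by
      intro z W hW
      have hz : z ∈ closure (W ∩ range stoneCechUnit) :=
        mem_closure_iff_nhds.2 fun N hN => by
          obtain ⟨w, hw, d, rfl⟩ := mem_closure_iff_nhds.1
            (denseRange_stoneCechUnit z) _ (inter_mem hN hW)
          exact ⟨_, hw.1, hw.2, d, rfl⟩
      refine closure_mono ?_ (image_closure_subset_closure_image hcont (mem_image_of_mem _ hz))
      rintro _ ⟨_, ⟨hd, d, rfl⟩, rfl⟩
      exact ⟨d, hd, (hext d).symm⟩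
    exact disjoint_left.1 (hR.disjoint_closure_image (hUc.preimage continuous_stoneCechUnit)
      (hVc.preimage continuous_stoneCechUnit) (hUV.preimage _)) (key hU) (hxy ▸ key hV)
  -- Surjectivity: the image is compact, hence closed, and contains the dense set D.
  · have hcl : IsClosed (range (stoneCechExtend hi)) :=
      (_root_.isCompact_range hcont).isClosed
    refine range_eq_univ.1 (eq_univ_of_univ_subset ?_)
    rw [← hR.dense_inducedSet.closure_eq]
    exact closure_minimal (fun d hd => ⟨stoneCechUnit ⟨d, hd⟩, hext ⟨d, hd⟩⟩) hcl

end IsRSkeleton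

theorem mainTheorem11 {K Γ : Type*} [TopologicalSpace K] [CompactSpace K] [T2Space K]
    [PartialOrder Γ] (R : Γ → K → K) (hR : IsRSkeleton R) :
    (Dense (inducedSet R) ∧
      ∀ A : Set K, A ⊆ inducedSet R → A.Countable →
        TopologicalSpace.MetrizableSpace (closure A) ∧ closure A ⊆ inducedSet R) ∧
    IsCountablyTight (inducedSet R) ∧
    NormalSpace (inducedSet R) ∧
    ∃ h : StoneCech (inducedSet R) ≃ₜ K, ∀ d : inducedSet R, h (stoneCechUnit d) = d := by
  refine ⟨⟨hR.dense_inducedSet, fun A hA hc => ?_⟩, hR.isCountablyTight,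
    hR.normalSpace_inducedSet, ?_⟩
  · obtain ⟨s₀⟩ := hR.nonempty
    obtain ⟨t, -, ht⟩ := hR.exists_ge_subset_range s₀ hA hc
    have hsub := hR.closure_subset_range ht
    have := hR.metrizable t
    exact ⟨(Topology.IsEmbedding.inclusion hsub).metrizableSpace,
      hsub.trans (subset_iUnion (fun s => range (R s)) t)⟩
  · let f := stoneCechExtend (continuous_subtype_val (p := (· ∈ inducedSet R)))
    have hf : Continuous f := continuous_stoneCechExtend _
    exact ⟨hf.homeoOfEquivCompactToT2 (f := Equiv.ofBijective f hR.stoneCechExtend_bijective),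
      congrFun (stoneCechExtend_extends continuous_subtype_val)⟩
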